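/- **Proposition.** Let $d\in\mathbb N$. For $\ell,L>0$ let $\mathcal S_{\ell,L}(\mathbb R^d)$ be the class of differentiable functions $W:\mathbb R^d\to\mathbb R$ such that for all $x_1,x_2\in\mathbb R^d$, $t\in[0,1]$, $$W((1-t)x_1+tx_2)\le(1-t)W(x_1)+tW(x_2)-\tfrac{\ell}{2}t(1-t)\|x_1-x_2\|^2,\qquad \|\nabla W(x_2)-\nabla W(x_1)\|\le L\|x_2-x_1\|.$$ Let $U\in\mathcal S_{\ell_U,L_U}(\mathbb R^d)$ and $V\in\mathcal S_{\ell_V,L_V}(\mathbb R^d)$, where $V$ is three times differentiable with $\sup_p\|\nabla^3V(p)\|\le T_V<\infty$ (operator norm of a trilinear form). Put $H(q,p)=U(q)+V(p)$, and let $\mathsf P$ be the probability measure on $\mathbb R^d\times\mathbb R^d$ with density proportional to $e^{-H(q,p)}$. Given potentials $S_0,S_1,\dots$ on $\mathbb R^d$, a step size $\eta>0$, an integer $K\ge1$ and a start $(q_0,p_0)$, define the leapfrog proposal $(q_K,p_K)$ by $$p_{k+\frac12}=p_k-\tfrac\eta2\nabla S_k(q_k),\quad q_{k+1}=q_k+\eta\nabla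 V(p_{k+\frac12}),\quad p_{k+1}=p_{k+\frac12}-\tfrac\eta2\nabla S_{k+1}(q_{k+1}),\qquad 0\le k<K,$$ and its Metropolis–Hastings acceptance probability by $A^{S}_{K,\eta}(q_0,p_0)=\exp\big(\min\{0,\,H(q_0,p_0)-H(q_K,p_K)\}\big)$. 1. (Exact gradients.) Suppose that $U$ is three times differentiable with $\sup_q\|\nabla^3U(q)\|\le T_U<\infty$, and take $S_k=U$ for all $k$. Then for all $\varrho,\delta\in(0,1)$ and every $K\ge1$ there is $\eta_0>0$ such that for every $\eta\in(0,\eta_0]$ there is a measurable set $D\subseteq\mathbb R^d\times\mathbb R^d$ with $\mathsf P(D)\ge1-\delta$ and $A^{S}_{K,\eta}(q,p)\ge\varrho$ for all $(q,p)\in D$. 2. (Stochastic gradients.) Let $S_k=U^{\omega}_k$, $k\ge0$, be random potentials on a probability space (independent of $(q_0,p_0)$, with arbitrary dependence among each other) such that $\nabla U_k^\omega(q)$ is a random vector for each $q$, and suppose that there are constants $0<\underline\ell\le\bar L<\infty$ and $\bar T>0$ such that, for each $k$, almost surely $U^\omega_k\in\mathcal S_{\ell^\omega,L^\omega}(\mathbb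 R^d)$ for some $\ell^\omega\ge\underline\ell$, $L^\omega\le\bar L$, and $U_k^\omega$ is three times differentiable with $\sup_q\|\nabla^3U_k^\omega(q)\|\le\bar T$. Then for all $\varrho,\delta\in(0,1)$ and every $K\ge1$ there is $\eta_0>0$ such that for every $\eta\in(0,\eta_0]$ there is a measurable set $D\subseteq\mathbb R^d\times\mathbb R^d$ with $\mathsf P(D)\ge1-\delta$ such that, for all $(q,p)\in D$, the probability $\mathbb E_\omega[A^{S}_{K,\eta}(q,p)]$ that the proposal from $(q,p)$ is accepted is at least $\varrho$, and moreover $A^{S}_{K,\eta}(q,p)\ge\varrho$ with probability at least $1-\delta$ over the gradient noise. -/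

import Mathlib

open MeasureTheory

noncomputable section

namespace HMC

/-- The position space and the momentum space `ℝᵈ`, with the Euclidean norm. -/
abbrev Space (d : ℕ) : Type := EuclideanSpace ℝ (Fin d)

/-- The class `𝒮_{ℓ,L}(ℝᵈ)`: differentiable, `ℓ`-strongly convex, with `L`-Lipschitz gradient. -/
structure InClassS {d : ℕ} (l L : ℝ) (W : Space d → ℝ) : Prop where
  l_pos : 0 < l
  L_pos : 0 < L
  differentiable : Differentiable ℝ W
  strongConvex : ∀ x₁ x₂ : Space d, ∀ t ∈ Set.Icc (0 : ℝ) 1,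
    W ((1 - t) • x₁ + t • x₂) ≤
      (1 - t) * W x₁ + t * W x₂ - l / 2 * t * (1 - t) * ‖x₁ - x₂‖ ^ 2
  gradient_lipschitz : ∀ x₁ x₂ : Space d,
    ‖gradient W x₂ - gradient W x₁‖ ≤ L * ‖x₂ - x₁‖

/-- `W` is three times differentiable and the operator norm of its third derivative (as a
trilinear form for the Euclidean norm) is at most `T` everywhere. -/
structure ThirdDerivBound {d : ℕ} (T : ℝ) (W : Space d → ℝ) : Prop where
  T_pos : 0 < T
  contDiff_two : ContDiff ℝ 2 W
  differentiable_second : Differentiable ℝ (iteratedFDeriv ℝ 2 W)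
  bound : ∀ x, ‖iteratedFDeriv ℝ 3 W x‖ ≤ T

/-- The probability measure on `ℝᵈ` with density proportional to `exp (-W)`. -/
def gibbs {d : ℕ} (W : Space d → ℝ) : Measure (Space d) :=
  (volume : Measure (Space d)).tilted (fun x => -W x)

/-- The joint law of `(q, p)`, where `q ∼ exp (-U)` and `p ∼ exp (-V)` are independent. -/
def jointLaw {d : ℕ} (U V : Space d → ℝ) : Measure (Space d × Space d) :=
  (gibbs U).prod (gibbs V)

/-- The Hamiltonian `H(q, p) = U(q) + V(p)`. -/
def hamiltonian {d : ℕ} (U V : Space d → ℝ) (z : Space d × Space d) : ℝ :=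
  U z.1 + V z.2

/-- One leapfrog step of size `η`, where `G` is the gradient field used at the current position
and `G'` the one used at the new position:
`p_{1/2} = p - (η/2) G(q)`, `q' = q + η ∇V(p_{1/2})`, `p' = p_{1/2} - (η/2) G'(q')`. -/
def leapfrogStep {d : ℕ} (G G' : Space d → Space d) (V : Space d → ℝ) (η : ℝ)
    (z : Space d × Space d) : Space d × Space d :=
  let pHalf := z.2 - (η / 2) • G z.1
  let q' := z.1 + η • gradient V pHalf
  (q', pHalf - (η / 2) • G' q')

/-- The state `(q_K, p_K)` after `K` leapfrog steps started at `z`, when the gradient at the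
position `q_k` is computed with the potential `S k`. In particular the same sample `S (k + 1)`
closes step `k` and opens step `k + 1`. -/
def leapfrog {d : ℕ} (S : ℕ → Space d → ℝ) (V : Space d → ℝ) (η : ℝ)
    (z : Space d × Space d) : ℕ → Space d × Space d
  | 0 => z
  | k + 1 => leapfrogStep (gradient (S k)) (gradient (S (k + 1))) V η (leapfrog S V η z k)

/-- The Metropolis-Hastings acceptance probability of the proposal `(q_K, p_K)` obtained from
`z = (q_0, p_0)` with the potentials `S k` in the leapfrog integrator:
`log A = min {0, H(q_0, p_0) - H(q_K, p_K)}`. The Hamiltonian always uses the exact `U`. -/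
def acceptProbWith {d : ℕ} (U V : Space d → ℝ) (S : ℕ → Space d → ℝ) (K : ℕ) (η : ℝ)
    (z : Space d × Space d) : ℝ :=
  Real.exp (min 0 (hamiltonian U V z - hamiltonian U V (leapfrog S V η z K)))

/-- The acceptance probability `A_{K,η}(q_0, p_0)` of HMC with exact gradients. -/
def acceptProb {d : ℕ} (U V : Space d → ℝ) (K : ℕ) (η : ℝ) (z : Space d × Space d) : ℝ :=
  acceptProbWith U V (fun _ => U) K η z

/-- The assumption on the stochastic gradients. `S k ω` is the random potential `U^ω` drawn for
the `k`-th gradient evaluation. Independence of the draws is not required: independent draws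
with a common law, and one draw kept along the whole trajectory, are both special cases. -/
structure StochasticGradient {d : ℕ} {Ω : Type*} [MeasurableSpace Ω] (μ : Measure Ω)
    (l L T : ℝ) (S : ℕ → Ω → Space d → ℝ) : Prop where
  l_pos : 0 < l
  l_le_L : l ≤ L
  T_pos : 0 < T
  measurable_gradient : ∀ k q, Measurable (fun ω => gradient (S k ω) q)
  classS : ∀ k, ∀ᵐ ω ∂μ, ∃ lω Lω : ℝ, l ≤ lω ∧ Lω ≤ L ∧ InClassS lω Lω (S k ω)
  thirdDeriv : ∀ k, ∀ᵐ ω ∂μ, ThirdDerivBound T (S k ω)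

end HMC

end

namespace HMC

open MeasureTheory Filter Topology

section Gradient

variable {d : ℕ} {l L : ℝ} {W : Space d → ℝ}

/-! With `K` fixed and `η → 0`, the proposal converges to its starting point, so a crude bound
suffices. If the gradients satisfy `‖∇S_k(q)‖ ≤ R + L‖q‖`, then `K` steps from a ball move a point
by `O(η)` (`exists_norm_leapfrog_sub_le`). As `H` is uniformly continuous on compact sets, the
energy error is below `-log ϱ` for small `η`, uniformly in the potentials
(`exists_le_acceptProbWith`).

Strong convexity makes the target a probability measure, so a ball carries mass `1 - δ`; it serves
as `D`. For noisy gradients `L` is deterministic and only the intercepts `‖∇S_k(0)‖` are random.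
Their finite sum is at most some `R` with probability close to one, however the draws depend on each
other, and on that event the deterministic estimate applies. Markov's inequality then bounds the
mean acceptance from below. -/

lemma InClassS.gradient_continuous (h : InClassS l L W) : Continuous (gradient W) := by
  refine (LipschitzWith.of_dist_le_mul (K := ⟨L, h.L_pos.le⟩) fun x y => ?_).continuous
  rw [dist_eq_norm, dist_eq_norm]
  exact h.gradient_lipschitz y x

lemma InClassS.norm_gradient_le (h : InClassS l L W) (x : Space d) :
    ‖gradient W x‖ ≤ ‖gradient W 0‖ + L * ‖x‖ := by
  have h₁ := h.gradient_lipschitz 0 x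
  rw [sub_zero] at h₁
  have h₂ := norm_add_le (gradient W 0) (gradient W x - gradient W 0)
  rw [add_sub_cancel] at h₂
  linarith

/-- A strongly convex differentiable function lies above a paraboloid touching it at `0`. -/
lemma InClassS.quadratic_lower_bound (h : InClassS l L W) (x : Space d) :
    W 0 + inner ℝ (gradient W 0) x + l / 2 * ‖x‖ ^ 2 ≤ W x := by
  have hd : HasDerivAt (fun t : ℝ => W (t • x)) (inner ℝ (gradient W 0) x) 0 := by
    have hW : HasFDerivAt W (fderiv ℝ W 0) ((0 : ℝ) • x) := by
      rw [zero_smul]; exact (h.differentiable 0).hasFDerivAt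
    have hl : HasDerivAt (fun t : ℝ => t • x) x 0 := by
      simpa using (hasDerivAt_id (0 : ℝ)).smul_const x
    have := hW.comp_hasDerivAt (0 : ℝ) hl
    rwa [inner_gradient_left]
  -- Strong convexity on `[0, x]`, divided by `t`, bounds the difference quotient at `0`; then let
  -- `t ↓ 0`.
  have hlim : Tendsto (fun t : ℝ => W x - W 0 - l / 2 * (1 - t) * ‖x‖ ^ 2) (𝓝[>] 0)
      (𝓝 (W x - W 0 - l / 2 * (1 - 0) * ‖x‖ ^ 2)) :=
    (Continuous.tendsto (by fun_prop) 0).mono_left nhdsWithin_le_nhds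
  have hle := le_of_tendsto_of_tendsto hd.tendsto_slope_zero_right hlim <| by
    filter_upwards [Ioo_mem_nhdsGT (zero_lt_one (α := ℝ))] with t ht
    have hc := h.strongConvex 0 x t ⟨ht.1.le, ht.2.le⟩
    simp only [smul_zero, zero_add, zero_sub, norm_neg] at hc
    simp only [zero_add, zero_smul, smul_eq_mul]
    rw [inv_mul_le_iff₀ ht.1]
    linarith
  linarith

/-- The quadratic lower bound dominates `exp (-W)` by a Gaussian with a linear term in the exponent.
-/
lemma InClassS.integrable_exp_neg (h : InClassS l L W) :
    Integrable (fun x => Real.exp (-W x)) (volume : Measure (Space d)) := by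
  have hb : 0 < ((l / 2 : ℝ) : ℂ).re := by
    rw [Complex.ofReal_re]; exact half_pos h.l_pos
  have hg := ((GaussianFourier.integrable_cexp_neg_mul_sq_norm_add hb (-1)
    (gradient W 0)).norm).const_mul (Real.exp (-W 0))
  refine hg.mono' (by
    have := h.differentiable.continuous
    exact (by fun_prop : Continuous fun x => Real.exp (-W x)).aestronglyMeasurable) ?_
  refine ae_of_all _ fun x => ?_
  rw [Real.norm_eq_abs, Real.abs_exp, Complex.norm_exp, ← Real.exp_add, Real.exp_le_exp]
  have hx := h.quadratic_lower_bound x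
  have : (-((l / 2 : ℝ) : ℂ) * (‖x‖ : ℂ) ^ 2 + -1 * ((inner ℝ (gradient W 0) x : ℝ) : ℂ)).re
      = -(l / 2) * ‖x‖ ^ 2 - inner ℝ (gradient W 0) x := by
    rw [← Complex.ofReal_re (-(l / 2) * ‖x‖ ^ 2 - inner ℝ (gradient W 0) x)]
    congr 1
    push_cast
    ring
  rw [this]
  linarith

lemma InClassS.isProbabilityMeasure_gibbs (h : InClassS l L W) :
    IsProbabilityMeasure (gibbs W) :=
  isProbabilityMeasure_tilted h.integrable_exp_neg

end Gradient

/-- A real random variable is bounded with probability as close to one as desired. -/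
lemma exists_measure_le_ge {Ω : Type*} [MeasurableSpace Ω] (μ : Measure Ω)
    [IsProbabilityMeasure μ] (f : Ω → ℝ) {c : ℝ} (hc : c < 1) :
    ∃ R : ℝ, ENNReal.ofReal c ≤ μ {ω | f ω ≤ R} := by
  have hm : Monotone fun R : ℝ => {ω | f ω ≤ R} := fun _ _ hab _ hω => le_trans hω hab
  -- Continuity from below holds for any increasing sets, so `f` need not be measurable.
  have ht := tendsto_measure_iUnion_atTop (μ := μ) hm
  have hu : ⋃ R : ℝ, {ω | f ω ≤ R} = Set.univ :=
    Set.eq_univ_of_forall fun ω => Set.mem_iUnion.2 ⟨f ω, le_refl (f ω)⟩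
  rw [hu, measure_univ] at ht
  have hc' : ENNReal.ofReal c < 1 := ENNReal.ofReal_lt_one.2 hc
  obtain ⟨R, hR⟩ := (ht.eventually (lt_mem_nhds hc')).exists
  exact ⟨R, hR.le⟩

section Energy

variable {d : ℕ} {V : Space d → ℝ}

/-- On a bounded set, a leapfrog step driven by fields of linear growth moves a point by `O(η)`,
uniformly in the fields. -/
lemma exists_norm_leapfrogStep_sub_le {lV LV : ℝ} (hV : InClassS lV LV V) {R L B : ℝ}
    (hR : 0 ≤ R) (hL : 0 ≤ L) (hB : 0 ≤ B) :
    ∃ C : ℝ, 0 ≤ C ∧ ∀ η ∈ Set.Icc (0 : ℝ) 1, ∀ G G' : Space d → Space d,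
      (∀ q, ‖G q‖ ≤ R + L * ‖q‖) → (∀ q, ‖G' q‖ ≤ R + L * ‖q‖) →
      ∀ z : Space d × Space d, ‖z‖ ≤ B → ‖leapfrogStep G G' V η z - z‖ ≤ η * C := by
  -- For `η ≤ 1`, `a`, `b`, `c` bound the first gradient, the velocity and the second gradient.
  set a := R + L * B with ha
  set b := ‖gradient V 0‖ + LV * (B + a) with hb
  set c := R + L * (B + b) with hc
  have hLV := hV.L_pos.le
  have ha0 : 0 ≤ a := by positivity
  have hb0 : 0 ≤ b := by positivity
  have hc0 : 0 ≤ c := by positivity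
  refine ⟨a + b + c, by positivity, fun η hη G G' hG hG' z hz => ?_⟩
  obtain ⟨hη0, hη1⟩ := hη
  have hz1 : ‖z.1‖ ≤ B := (norm_fst_le z).trans hz
  have hz2 : ‖z.2‖ ≤ B := (norm_snd_le z).trans hz
  have hGz : ‖G z.1‖ ≤ a := (hG _).trans (by rw [ha]; gcongr)
  set p := z.2 - (η / 2) • G z.1 with hp
  have hkick : ∀ v : Space d, ‖(η / 2) • v‖ = η / 2 * ‖v‖ := fun v => by
    rw [norm_smul, Real.norm_of_nonneg (by linarith)]
  have hpn : ‖p‖ ≤ B + a := by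
    refine (norm_sub_le _ _).trans (add_le_add hz2 ?_)
    rw [hkick]
    nlinarith [norm_nonneg (G z.1)]
  have hVp : ‖gradient V p‖ ≤ b := (hV.norm_gradient_le p).trans (by rw [hb]; gcongr)
  set q := z.1 + η • gradient V p with hq
  have hdrift : ‖η • gradient V p‖ ≤ η * b := by
    rw [norm_smul, Real.norm_of_nonneg hη0]; gcongr
  have hqn : ‖q‖ ≤ B + b := by
    refine (norm_add_le _ _).trans (add_le_add hz1 (hdrift.trans ?_))
    nlinarith
  have hGq : ‖G' q‖ ≤ c := (hG' _).trans (by rw [hc]; gcongr)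
  have hstep : leapfrogStep G G' V η z - z
      = (η • gradient V p, -((η / 2) • G z.1) - (η / 2) • G' q) := by
    ext1
    · change z.1 + η • gradient V p - z.1 = _
      module
    · change z.2 - (η / 2) • G z.1 - (η / 2) • G' q - z.2 = _
      module
  rw [hstep, Prod.norm_mk, max_le_iff]
  constructor
  · exact hdrift.trans (by gcongr; linarith)
  · refine (norm_sub_le _ _).trans ?_
    rw [norm_neg, hkick, hkick]
    nlinarith [norm_nonneg (G z.1), norm_nonneg (G' q)]

/-- On a bounded set of starting points, `K` leapfrog steps move a point by `O(η)`, uniformly in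
the potentials as long as their gradients have a common linear growth. -/
lemma exists_norm_leapfrog_sub_le {lV LV : ℝ} (hV : InClassS lV LV V) {R L B : ℝ}
    (hR : 0 ≤ R) (hL : 0 ≤ L) (hB : 0 ≤ B) (K : ℕ) :
    ∃ C : ℝ, 0 ≤ C ∧ ∀ η ∈ Set.Icc (0 : ℝ) 1, ∀ S : ℕ → Space d → ℝ,
      (∀ k ≤ K, ∀ q, ‖gradient (S k) q‖ ≤ R + L * ‖q‖) →
      ∀ z : Space d × Space d, ‖z‖ ≤ B → ‖leapfrog S V η z K - z‖ ≤ η * C := by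
  induction K with
  | zero => exact ⟨0, le_rfl, fun η _ S _ z _ => by simp [leapfrog]⟩
  | succ K ih =>
    obtain ⟨C, hC0, hC⟩ := ih
    obtain ⟨C', hC'0, hC'⟩ := exists_norm_leapfrogStep_sub_le hV hR hL (add_nonneg hB hC0)
    refine ⟨C' + C, by positivity, fun η hη S hS z hz => ?_⟩
    have h₁ := hC η hη S (fun k hk => hS k (by omega)) z hz
    have h₂ : ‖leapfrog S V η z K‖ ≤ B + C := by
      have h₃ := norm_add_le z (leapfrog S V η z K - z)
      rw [add_sub_cancel] at h₃
      nlinarith [hη.2]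
    have h₃ := hC' η hη _ _ (hS K (by omega)) (hS (K + 1) le_rfl) _ h₂
    rw [mul_add]
    exact (norm_sub_le_norm_sub_add_norm_sub _ (leapfrog S V η z K) _).trans (add_le_add h₃ h₁)

/-- For small step sizes the acceptance probability exceeds any `ϱ < 1` on a given bounded set,
uniformly in the potentials driving the leapfrog integrator, as long as their gradients have a
common linear growth. -/
lemma exists_le_acceptProbWith {U : Space d → ℝ} (hU : Continuous U) {lV LV : ℝ}
    (hV : InClassS lV LV V) {R L B : ℝ}
    (hR : 0 ≤ R) (hL : 0 ≤ L) (hB : 0 ≤ B) (K : ℕ) {ϱ : ℝ} (hϱ : ϱ ∈ Set.Ioo (0 : ℝ) 1) :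
    ∃ η₀ : ℝ, 0 < η₀ ∧ ∀ η ∈ Set.Ioc (0 : ℝ) η₀, ∀ S : ℕ → Space d → ℝ,
      (∀ k ≤ K, ∀ q, ‖gradient (S k) q‖ ≤ R + L * ‖q‖) →
      ∀ z : Space d × Space d, ‖z‖ ≤ B → ϱ ≤ acceptProbWith U V S K η z := by
  obtain ⟨C, hC0, hC⟩ := exists_norm_leapfrog_sub_le hV hR hL hB K
  have hH : Continuous (hamiltonian U V) :=
    (hU.comp continuous_fst).add (hV.differentiable.continuous.comp continuous_snd)
  have huc := (isCompact_closedBall (0 : Space d × Space d) (B + C)).uniformContinuousOn_of_continuous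
    hH.continuousOn
  have hlog : 0 < -Real.log ϱ := neg_pos.2 (Real.log_neg hϱ.1 hϱ.2)
  obtain ⟨r, hr, hHr⟩ := Metric.uniformContinuousOn_iff.1 huc _ hlog
  -- `C + 1` allows `C = 0` and makes the displacement strictly less than `r`.
  refine ⟨min 1 (r / (C + 1)), by positivity, fun η hη S hS z hz => ?_⟩
  have hη1 : η ≤ 1 := hη.2.trans (min_le_left _ _)
  have hηr : η * (C + 1) ≤ r :=
    (le_div_iff₀ (by positivity)).1 (hη.2.trans (min_le_right _ _))
  have hmove := hC η ⟨hη.1.le, hη1⟩ S hS z hz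
  have hnorm : ‖leapfrog S V η z K‖ ≤ B + C := by
    have h₃ := norm_add_le z (leapfrog S V η z K - z)
    rw [add_sub_cancel] at h₃
    nlinarith
  have hd := hHr z (by rw [mem_closedBall_zero_iff]; linarith) (leapfrog S V η z K)
    (by rwa [mem_closedBall_zero_iff]) (by
      rw [dist_comm, dist_eq_norm]
      nlinarith [hη.1])
  rw [Real.dist_eq] at hd
  rw [acceptProbWith, ← Real.log_le_iff_le_exp hϱ.1]
  refine le_min (by linarith) ?_
  linarith [(abs_lt.1 hd).1]

end Energy

section Measurability

/-- Evaluating an almost surely continuous random field at a random point. -/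
lemma aemeasurable_eval_of_ae_continuous {Ω E F : Type*} [MeasurableSpace Ω] {μ : Measure Ω}
    [TopologicalSpace E] [TopologicalSpace.MetrizableSpace E] [SecondCountableTopology E]
    [MeasurableSpace E] [OpensMeasurableSpace E] [TopologicalSpace F] [Zero F]
    [TopologicalSpace.PseudoMetrizableSpace F] [MeasurableSpace F] [BorelSpace F]
    {G : Ω → E → F} (hG : ∀ q, Measurable fun ω => G ω q) (hc : ∀ᵐ ω ∂μ, Continuous (G ω))
    {q : Ω → E} (hq : AEMeasurable q μ) : AEMeasurable (fun ω => G ω (q ω)) μ := by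
  classical
  -- Replacing the field by `0` on a measurable null set makes it continuous for every `ω`, hence
  -- jointly measurable.
  obtain ⟨N, hN, hNm, hN0⟩ := exists_measurable_superset_of_null (ae_iff.1 hc)
  have hu : Measurable (Function.uncurry fun (x : E) (ω : Ω) => if ω ∈ N then 0 else G ω x) := by
    refine measurable_uncurry_of_continuous_of_measurable (fun ω => ?_) fun x =>
      Measurable.ite hNm measurable_const (hG x)
    by_cases hω : ω ∈ N
    · simpa [hω] using continuous_const
    · simp only [hω, if_false]
      by_contra hcon
      exact hω (hN hcon)
  refine ⟨_, hu.comp (hq.measurable_mk.prodMk measurable_id), ?_⟩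
  filter_upwards [hq.ae_eq_mk, measure_eq_zero_iff_ae_notMem.1 hN0] with ω h₁ h₂
  simp [Function.uncurry, h₂, h₁]

variable {d : ℕ} {Ω : Type*} [MeasurableSpace Ω] {μ : Measure Ω} {S : ℕ → Ω → Space d → ℝ}
  {U V : Space d → ℝ}

lemma aemeasurable_leapfrog (hS : ∀ k q, Measurable fun ω => gradient (S k ω) q)
    (hc : ∀ k, ∀ᵐ ω ∂μ, Continuous (gradient (S k ω))) (hV : Continuous (gradient V))
    (η : ℝ) (z : Space d × Space d) (K : ℕ) :
    AEMeasurable (fun ω => leapfrog (fun k => S k ω) V η z K) μ := by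
  induction K with
  | zero => exact aemeasurable_const
  | succ K ih =>
    have hp := ih.snd.sub
      ((aemeasurable_eval_of_ae_continuous (hS K) (hc K) ih.fst).const_smul (η / 2))
    have hq := ih.fst.add ((hV.measurable.comp_aemeasurable hp).const_smul η)
    have hp' := hp.sub ((aemeasurable_eval_of_ae_continuous (hS (K + 1)) (hc (K + 1))
      hq).const_smul (η / 2))
    exact hq.prodMk hp'

lemma integrable_acceptProbWith [IsFiniteMeasure μ]
    (hS : ∀ k q, Measurable fun ω => gradient (S k ω) q)
    (hc : ∀ k, ∀ᵐ ω ∂μ, Continuous (gradient (S k ω))) (hU : Continuous U) (hV : Continuous V)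
    (hV' : Continuous (gradient V)) (η : ℝ) (z : Space d × Space d) (K : ℕ) :
    Integrable (fun ω => acceptProbWith U V (fun k => S k ω) K η z) μ := by
  have hH : Continuous (hamiltonian U V) :=
    (hU.comp continuous_fst).add (hV.comp continuous_snd)
  have hA : Continuous fun w => Real.exp (min 0 (hamiltonian U V z - hamiltonian U V w)) := by
    fun_prop
  refine Integrable.of_bound (hA.measurable.comp_aemeasurable
    (aemeasurable_leapfrog hS hc hV' η z K)).aestronglyMeasurable 1 (ae_of_all _ fun ω => ?_)
  rw [acceptProbWith, Real.norm_eq_abs, Real.abs_exp]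
  exact Real.exp_le_one_iff.2 (min_le_left _ _)

end Measurability

/-- Some centred ball carries as much of the mass of the joint law as desired. -/
lemma exists_jointLaw_closedBall_ge {d : ℕ} {U V : Space d → ℝ} {lU LU lV LV : ℝ}
    (hU : InClassS lU LU U) (hV : InClassS lV LV V) {c : ℝ} (hc : c < 1) :
    ∃ B : ℝ, 0 ≤ B ∧ ENNReal.ofReal c ≤ jointLaw U V (Metric.closedBall 0 B) := by
  have := hU.isProbabilityMeasure_gibbs
  have := hV.isProbabilityMeasure_gibbs
  have : IsProbabilityMeasure (jointLaw U V) := by unfold jointLaw; infer_instance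
  obtain ⟨B, hB⟩ := exists_measure_le_ge (jointLaw U V) (fun z => ‖z‖) hc
  refine ⟨max B 0, le_max_right _ _, hB.trans (measure_mono fun z hz => ?_)⟩
  rw [mem_closedBall_zero_iff]
  exact le_max_of_le_left hz

end HMC

theorem mainTheorem9 {d : ℕ} (U V : HMC.Space d → ℝ) (lU LU lV LV TV : ℝ)
    (hU : HMC.InClassS lU LU U) (hV : HMC.InClassS lV LV V) (hV3 : HMC.ThirdDerivBound TV V) :
    -- exact gradients
    (∀ TU : ℝ, HMC.ThirdDerivBound TU U →
      ∀ ϱ ∈ Set.Ioo (0 : ℝ) 1, ∀ δ ∈ Set.Ioo (0 : ℝ) 1, ∀ K : ℕ, 1 ≤ K →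
        ∃ η₀ : ℝ, 0 < η₀ ∧ ∀ η ∈ Set.Ioc (0 : ℝ) η₀,
          ∃ D : Set (HMC.Space d × HMC.Space d), MeasurableSet D ∧
            ENNReal.ofReal (1 - δ) ≤ HMC.jointLaw U V D ∧
            ∀ z ∈ D, ϱ ≤ HMC.acceptProb U V K η z) ∧
    -- stochastic gradients
    (∀ (Ω : Type*) [MeasurableSpace Ω] (μ : MeasureTheory.Measure Ω)
      [MeasureTheory.IsProbabilityMeasure μ] (l L T : ℝ) (S : ℕ → Ω → HMC.Space d → ℝ),
      HMC.StochasticGradient μ l L T S →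
      ∀ ϱ ∈ Set.Ioo (0 : ℝ) 1, ∀ δ ∈ Set.Ioo (0 : ℝ) 1, ∀ K : ℕ, 1 ≤ K →
        ∃ η₀ : ℝ, 0 < η₀ ∧ ∀ η ∈ Set.Ioc (0 : ℝ) η₀,
          ∃ D : Set (HMC.Space d × HMC.Space d), MeasurableSet D ∧
            ENNReal.ofReal (1 - δ) ≤ HMC.jointLaw U V D ∧
            ∀ z ∈ D,
              ϱ ≤ ∫ ω, HMC.acceptProbWith U V (fun k => S k ω) K η z ∂μ ∧
              ENNReal.ofReal (1 - δ) ≤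
                μ {ω | ϱ ≤ HMC.acceptProbWith U V (fun k => S k ω) K η z}) := by
  obtain ⟨hUc, hVc⟩ := And.intro hU.differentiable.continuous hV.differentiable.continuous
  constructor
  · intro TU _ ϱ hϱ δ hδ K _
    obtain ⟨B, hB0, hB⟩ := HMC.exists_jointLaw_closedBall_ge hU hV (sub_lt_self 1 hδ.1)
    obtain ⟨η₀, hη₀, hacc⟩ := HMC.exists_le_acceptProbWith hUc hV
      (norm_nonneg (gradient U 0)) hU.L_pos.le hB0 K hϱ
    exact ⟨η₀, hη₀, fun η hη => ⟨Metric.closedBall 0 B, measurableSet_closedBall, hB, fun z hz =>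
      hacc η hη (fun _ => U) (fun _ _ => hU.norm_gradient_le) z (mem_closedBall_zero_iff.1 hz)⟩⟩
  · intro Ω _ μ _ l L T S hS ϱ hϱ δ hδ K _
    have hL : 0 ≤ L := hS.l_pos.le.trans hS.l_le_L
    -- both the acceptance level and the probability of the good noise are raised to `s`
    obtain ⟨s, hs, hϱs, hδs, hss⟩ : ∃ s ∈ Set.Ioo (0 : ℝ) 1, ϱ ≤ s ∧ 1 - δ ≤ s ∧ ϱ ≤ s * s := by
      have hm : max ϱ (1 - δ) < 1 := max_lt hϱ.2 (by linarith [hδ.1])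
      have h₁ := le_max_left ϱ (1 - δ)
      have h₂ := le_max_right ϱ (1 - δ)
      -- With `m` the maximum and `s = (1 + m) / 2`, `s² - m = (1 - m)² / 4 ≥ 0`.
      refine ⟨(1 + max ϱ (1 - δ)) / 2, ⟨?_, ?_⟩, ?_, ?_, ?_⟩
      · linarith [hϱ.1]
      · linarith
      · linarith
      · linarith
      · nlinarith [sq_nonneg (1 - max ϱ (1 - δ))]
    obtain ⟨B, hB0, hB⟩ := HMC.exists_jointLaw_closedBall_ge hU hV (sub_lt_self 1 hδ.1)
    -- `K` steps use the `K + 1` potentials `S 0, …, S K`; the sum bounds each intercept.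
    obtain ⟨R, hR⟩ := HMC.exists_measure_le_ge μ
      (fun ω => ∑ k ∈ Finset.range (K + 1), ‖gradient (S k ω) 0‖) hs.2
    obtain ⟨η₀, hη₀, hacc⟩ := HMC.exists_le_acceptProbWith hUc hV
      (le_max_right R 0) hL hB0 K hs
    refine ⟨η₀, hη₀, fun η hη => ⟨Metric.closedBall 0 B, measurableSet_closedBall, hB,
      fun z hz => ?_⟩⟩
    have hcont : ∀ k, ∀ᵐ ω ∂μ, Continuous (gradient (S k ω)) := fun k => by
      filter_upwards [hS.classS k] with ω ⟨_, _, _, _, h⟩ using h.gradient_continuous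
    have hgood : ENNReal.ofReal s ≤
        μ {ω | s ≤ HMC.acceptProbWith U V (fun k => S k ω) K η z} := by
      refine hR.trans (measure_mono_ae ?_)
      filter_upwards [ae_all_iff.2 hS.classS] with ω hω hωR
      refine hacc η hη _ (fun k hk q => ?_) z (mem_closedBall_zero_iff.1 hz)
      obtain ⟨_, Lω, _, hLω, h⟩ := hω k
      refine (h.norm_gradient_le q).trans (add_le_add (le_max_of_le_left ?_) (by gcongr))
      exact (Finset.single_le_sum (f := fun k => ‖gradient (S k ω) 0‖)
        (fun _ _ => norm_nonneg _) (Finset.mem_range.2 (by omega))).trans hωR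
    have hint := HMC.integrable_acceptProbWith hS.measurable_gradient hcont hUc hVc
      hV.gradient_continuous η z K
    constructor
    -- Markov: `𝔼 A ≥ s · μ(A ≥ s) ≥ s² ≥ ϱ`.
    · have hmarkov := mul_meas_ge_le_integral_of_nonneg
        (ae_of_all μ fun ω => (Real.exp_pos _).le) hint s
      have hreal : s ≤ μ.real {ω | s ≤ HMC.acceptProbWith U V (fun k => S k ω) K η z} :=
        (ENNReal.ofReal_le_iff_le_toReal (measure_ne_top _ _)).1 hgood
      exact (hss.trans (mul_le_mul_of_nonneg_left hreal hs.1.le)).trans hmarkov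
    · exact (ENNReal.ofReal_le_ofReal hδs).trans
        (hgood.trans (measure_mono fun ω hω => hϱs.trans hω))
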